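/- Let $X$ be a tree and let $\Delta$ be a collection of embeddings of trees $\gamma\colon Y\to X$. The associated tree with fins $\mathbf X$ is the mapping cylinder of $\bigsqcup_{\Delta}Y\to X$, that is, the square complex $X\sqcup\bigsqcup_{\Delta}(Y\times[0,1])/\!\sim$ with $(y,0)\sim\gamma(y)$, whose squares are the products $e\times[0,1]$ for edges $e$ of the trees $Y$; it contains $X$ as its underlying tree. Let $\operatorname{Aut}(\mathbf X)$ be the group of cubical automorphisms of $\mathbf X$ that preserve $X$. A subgroup $\Gamma<\operatorname{Aut}(\mathbf X)$ is a uniform lattice if it acts properly and cocompactly on $\mathbf X$, i.e. its action on the vertices of $\mathbf X$ has finite stabilisers and finitely many orbits; $\mathbf X$ is uniform if $\operatorname{Aut}(\mathbf X)$ contains a uniform lattice. **Theorem.** There exists a locally finite uniform tree with fins $\mathbf X$ with the following properties. 1. There is no uniform lattice $\Gamma<\operatorname{Aut}(\mathbf X)$ such that the natural map $\Gamma\backslash\mathbf X\to\operatorname{Aut}(\mathbf X)\backslash\mathbf X$ is an isomorphism (indeed, for no uniform lattice $\Gamma$ is the induced map from $\Gamma$-orbits of cells to $\operatorname{Aut}(\mathbf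 X)$-orbits of cells a bijection). 2. For a vertex $x$ of $X$, let $E_X(x)$ be the set of edges of $X$ incident to $x$. There is no uniform lattice $\Gamma<\operatorname{Aut}(\mathbf X)$ such that, for every vertex $x$ of $X$, every permutation of $E_X(x)$ induced by an element of the stabiliser $\operatorname{Aut}(\mathbf X)_x$ is also induced by an element of $\Gamma_x$. -/

import Mathlib

/-- The data of a tree with fins: a tree `X` (the underlying tree) with vertex set `V`, and a
collection, indexed by `ι`, of embeddings of trees `γ i : Y i → X`. -/
structure TreeWithFins where
  /-- The vertices of the underlying tree. -/
  V : Type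
  /-- The underlying tree. -/
  tree : SimpleGraph V
  isTree : tree.IsTree
  /-- The index set of the collection of fins. -/
  ι : Type
  /-- The vertices of the fins. -/
  Y : ι → Type
  /-- The fins. -/
  fin : (i : ι) → SimpleGraph (Y i)
  fin_isTree : ∀ i, (fin i).IsTree
  /-- The embedding along which a fin is attached to the underlying tree. -/
  γ : (i : ι) → fin i ↪g tree

namespace TreeWithFins

variable (X : TreeWithFins)

/-- The vertices of the square complex: the mapping cylinder of `⊔ Y i → X` has the vertices of `X`
and, for every fin, the vertices `(y, 1)` with `y` a vertex of `Y i`. -/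
abbrev Vert : Type := X.V ⊕ (Σ i, X.Y i)

/-- The vertex of the square complex given by a vertex of the underlying tree. -/
def onTree (v : X.V) : X.Vert := Sum.inl v

/-- The vertex `(y, 1)` of the square complex given by a vertex `y` of the `i`-th fin. -/
def onFin (i : X.ι) (y : X.Y i) : X.Vert := Sum.inr ⟨i, y⟩

/-- The closed cells of the mapping cylinder, each recorded by its set of vertices (different cells
have different vertex sets): vertices, edges of `X`, edges of the fins, the edges `y × [0, 1]`
for a vertex `y` of a fin, and the squares `e × [0, 1]` for an edge `e` of a fin, where `(y, 0)` is
identified with `γ i y`. -/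
inductive IsCell : Set X.Vert → Prop
  | treeVertex (v : X.V) : IsCell {X.onTree v}
  | finVertex (i : X.ι) (y : X.Y i) : IsCell {X.onFin i y}
  | treeEdge (v w : X.V) (h : X.tree.Adj v w) : IsCell {X.onTree v, X.onTree w}
  | finEdge (i : X.ι) (y z : X.Y i) (h : (X.fin i).Adj y z) :
      IsCell {X.onFin i y, X.onFin i z}
  | verticalEdge (i : X.ι) (y : X.Y i) : IsCell {X.onTree (X.γ i y), X.onFin i y}
  | square (i : X.ι) (y z : X.Y i) (h : (X.fin i).Adj y z) :
      IsCell {X.onTree (X.γ i y), X.onTree (X.γ i z), X.onFin i y, X.onFin i z}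

/-- The cells (vertices, edges and squares) of the square complex. -/
def Cell : Type := {c : Set X.Vert // X.IsCell c}

/-- The square complex is locally finite: every vertex lies in finitely many cells. -/
def LocallyFinite : Prop := ∀ v : X.Vert, {c : Set X.Vert | X.IsCell c ∧ v ∈ c}.Finite

/-- The automorphism group: the cubical automorphisms (bijections of the vertices which, together
with their inverses, take cells to cells) that preserve the underlying tree. -/
def Aut : Subgroup (Equiv.Perm X.Vert) where
  carrier := {g | (∀ c : Set X.Vert, X.IsCell (g '' c) ↔ X.IsCell c) ∧
    g '' Set.range X.onTree = Set.range X.onTree}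
  one_mem' := by simp
  mul_mem' := by
    rintro g h ⟨hg, hg'⟩ ⟨hh, hh'⟩
    refine ⟨fun c => ?_, ?_⟩
    · rw [Equiv.Perm.coe_mul, Set.image_comp, hg, hh]
    · rw [Equiv.Perm.coe_mul, Set.image_comp, hh', hg']
  inv_mem' := by
    rintro g ⟨hg, hg'⟩
    have key : ∀ c : Set X.Vert, g '' ((g⁻¹ : Equiv.Perm X.Vert) '' c) = c := fun c => by
      rw [← Set.image_comp, ← Equiv.Perm.coe_mul, mul_inv_cancel, Equiv.Perm.coe_one,
        Set.image_id]
    refine ⟨fun c => ?_, ?_⟩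
    · rw [← hg, key]
    · apply g.injective.image_injective
      rw [key, hg']

/-- Automorphisms act on the cells. -/
instance : MulAction X.Aut X.Cell where
  smul g c := ⟨(g : Equiv.Perm X.Vert) '' c.1, (g.2.1 c.1).2 c.2⟩
  one_smul c := Subtype.ext (Set.image_id c.1)
  mul_smul g h c := Subtype.ext
    (Set.image_comp (g : Equiv.Perm X.Vert) (h : Equiv.Perm X.Vert) c.1)

variable {X}

/-- A uniform lattice: a subgroup of the automorphism group that acts properly and cocompactly, i.e.
its action on the vertices has finite stabilisers and finitely many orbits. -/
def IsUniformLattice (Γ : Subgroup X.Aut) : Prop :=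
  (∀ v : X.Vert, Finite (MulAction.stabilizer Γ v)) ∧
    Finite (MulAction.orbitRel.Quotient Γ X.Vert)

/-- The natural map `Γ \ X → Aut X \ X` on the cells of the quotients, i.e. from `Γ`-orbits of cells
to `Aut X`-orbits of cells. -/
def quotientMap (Γ : Subgroup X.Aut) :
    MulAction.orbitRel.Quotient Γ X.Cell → MulAction.orbitRel.Quotient X.Aut X.Cell :=
  Quotient.map id fun _ _ ⟨g, hg⟩ => ⟨g.1, hg⟩

variable (X)

/-- A tree with fins is uniform if its automorphism group contains a uniform lattice. -/
def IsUniform : Prop := ∃ Γ : Subgroup X.Aut, IsUniformLattice Γ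

/-- The edges of the underlying tree that are incident to `x`. -/
def edgesAt (x : X.V) : Set (Set X.Vert) :=
  {e | ∃ w, X.tree.Adj x w ∧ e = {X.onTree x, X.onTree w}}

/-- The automorphism `g` fixes the vertex `x` of the underlying tree and induces the
permutation `π` of the edges of the underlying tree incident to `x`. -/
def Induces (x : X.V) (g : X.Aut) (π : Equiv.Perm (X.edgesAt x)) : Prop :=
  g • X.onTree x = X.onTree x ∧
    ∀ e : X.edgesAt x, (π e : Set X.Vert) = (g : Equiv.Perm X.Vert) '' (e : Set X.Vert)

end TreeWithFins

/-! The underlying tree is the trivalent Cayley tree of `Z/2 * Z/2 * Z/2`, with edges labelled by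
`none`, `some false`, `some true`. The short fins lie along the `none` edges and force every
automorphism to preserve that label (`treeMap_mul_gen_none`). At each vertex `v` an automorphism
therefore either keeps or swaps the two other labels, which is recorded by a sign in `Z/2`. The sign
is constant along each line of `some` edges (`sign_mul_gen_some`).

The long fins relate the signs of different lines. Their labels satisfy `c = a + b`, and preserving
this relation means that moving two steps along a line of sign `s` changes the sign of the line
across the `none` edge by `s` (`sign_long`).

Suppose that `g` fixes `v` with sign 1, a "reflection". It exchanges the vertices `w` and `w'`
reached from `v` by `some false, none` and `some true, none`. The signs of `g` at `w` and `w'`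
differ, so `g ^ 2` fixes `w` with sign 1 and is again a reflection (`IsReflection.sq`). Iterating,
`g` has infinite order, so no uniform lattice contains a reflection, since vertex stabilisers in a
lattice are finite.

The sign conditions are nevertheless consistent: a finite-state transducer solves them with sign 1
at the identity (`exists_isFlip`), so `finned.Aut` contains a reflection at 1. A lattice with the
same orbits of cells, or with the same local permutations, would have to contain one too. Left
translations form a uniform lattice. -/

/-! ### Reduced words, the free product and its Cayley tree. -/

/-- The free product `Z/2 * Z/2 * Z/2`, as the set of reduced words in the generators
`none` and `some b`, the last letter of a word being the head of the list. -/
def FreeInvolutions : Type := {l : List (Option Bool) // l.IsChain (· ≠ ·)}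

namespace FreeInvolutions

instance : DecidableEq FreeInvolutions :=
  inferInstanceAs (DecidableEq {l : List (Option Bool) // l.IsChain (· ≠ ·)})

/-- Multiplication of a reduced word by a generator on the right. -/
def step (v : FreeInvolutions) (c : Option Bool) : FreeInvolutions :=
  if h : v.1.head? = some c then ⟨v.1.tail, v.2.tail⟩
  else ⟨c :: v.1, by
    rcases v with ⟨_ | ⟨a, t⟩, hv⟩
    · exact List.isChain_singleton c
    · exact List.isChain_cons_cons.2 ⟨fun e => h (by simp [e]), hv⟩⟩

instance : One FreeInvolutions := ⟨⟨[], List.isChain_nil⟩⟩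

/-- Extending a word by a letter different from its last one. -/
theorem step_of_head_ne {v : FreeInvolutions} {c : Option Bool} (h : v.1.head? ≠ some c) :
    (v.step c).1 = c :: v.1 := by simp [step, h]

/-- Cancelling the last letter of a word. -/
theorem step_of_head_eq {v : FreeInvolutions} {c : Option Bool} (h : v.1.head? = some c) :
    (v.step c).1 = v.1.tail := by simp [step, h]

theorem step_step (v : FreeInvolutions) (c : Option Bool) : (v.step c).step c = v := by
  apply Subtype.ext
  by_cases h : v.1.head? = some c
  · have h1 := step_of_head_eq h
    rcases v with ⟨_ | ⟨a, t⟩, hv⟩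
    · simp at h
    · obtain rfl : a = c := by simpa using h
      have : (step ⟨a :: t, hv⟩ a).1.head? ≠ some a := by
        rw [h1]
        rcases t with _ | ⟨b, t⟩
        · simp
        · simpa using (List.isChain_cons_cons.1 hv).1.symm
      rw [step_of_head_ne this, h1]
      rfl
  · have h1 := step_of_head_ne h
    rw [step_of_head_eq (by rw [h1]; rfl), h1]
    rfl

@[elab_as_elim]
theorem step_induction {P : FreeInvolutions → Prop} (one : P 1)
    (step : ∀ v c, P v → P (v.step c)) (v : FreeInvolutions) : P v := by
  obtain ⟨l, hl⟩ := v
  induction l with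
  | nil => exact one
  | cons c t ih =>
    have h : t.head? ≠ some c := by
      rcases t with _ | ⟨b, t⟩
      · simp
      · simpa using (List.isChain_cons_cons.1 hl).1.symm
    have h1 : (⟨c :: t, hl⟩ : FreeInvolutions) = FreeInvolutions.step ⟨t, hl.tail⟩ c :=
      Subtype.ext (step_of_head_ne (v := ⟨t, hl.tail⟩) h).symm
    exact h1 ▸ step ⟨t, hl.tail⟩ c (ih hl.tail)

/-- The map from the free product given by a base point and an action of the generators by
involutions. -/
def lift {Z : Type*} (ρ : Option Bool → Z → Z) (z : Z) (v : FreeInvolutions) : Z :=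
  v.1.foldr ρ z

theorem lift_one {Z : Type*} (ρ : Option Bool → Z → Z) (z : Z) : lift ρ z 1 = z := rfl

/-- The universal property of the free product: cancelling a letter is matched by `ρ c` being an
involution. It yields the multiplication, the inverses of label flips and the runs of the
transducer. -/
theorem lift_step {Z : Type*} {ρ : Option Bool → Z → Z} (hρ : ∀ c z, ρ c (ρ c z) = z) (z : Z)
    (v : FreeInvolutions) (c : Option Bool) : lift ρ z (v.step c) = ρ c (lift ρ z v) := by
  unfold lift
  by_cases h : v.1.head? = some c
  · rw [step_of_head_eq h]
    rcases v with ⟨_ | ⟨a, t⟩, hv⟩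
    · simp at h
    · obtain rfl : a = c := by simpa using h
      simp [hρ]
  · rw [step_of_head_ne h]
    rfl

instance : Mul FreeInvolutions := ⟨fun u v => lift (fun c z => z.step c) u v⟩

/-- Generators are involutions, so the inverse is the reversed word; `foldl` meets the last letter
first. -/
instance : Inv FreeInvolutions :=
  ⟨fun v => v.1.foldl (fun z c => z.step c) 1⟩

theorem mul_step (u v : FreeInvolutions) (c : Option Bool) : u * v.step c = (u * v).step c :=
  lift_step (fun c z => step_step z c) u v c

theorem mul_assoc' (u v w : FreeInvolutions) : u * v * w = u * (v * w) := by
  induction w using step_induction with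
  | one => rfl
  | step w c ih => rw [mul_step, mul_step, mul_step, ih]

theorem one_mul' (u : FreeInvolutions) : 1 * u = u := by
  induction u using step_induction with
  | one => rfl
  | step w c ih => rw [mul_step, ih]

theorem inv_mul' (u : FreeInvolutions) : u⁻¹ * u = 1 := by
  suffices ∀ (l : List (Option Bool)) (z : FreeInvolutions),
      l.foldr (fun c z => z.step c) (l.foldl (fun z c => z.step c) z) = z from this u.1 1
  intro l
  induction l with
  | nil => intro z; rfl
  | cons c t ih => intro z; rw [List.foldr_cons, List.foldl_cons, ih, step_step]

instance : Group FreeInvolutions :=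
  Group.ofLeftAxioms mul_assoc' one_mul' inv_mul'

/-- The generators. -/
def gen (c : Option Bool) : FreeInvolutions := (1 : FreeInvolutions).step c

theorem mul_gen (v : FreeInvolutions) (c : Option Bool) : v * gen c = v.step c := by
  rw [gen, mul_step, mul_one]

@[simp] theorem gen_mul_gen (c : Option Bool) : gen c * gen c = 1 := by
  rw [mul_gen, gen, step_step]

@[simp] theorem mul_gen_gen (v : FreeInvolutions) (c : Option Bool) :
    v * gen c * gen c = v := by
  rw [mul_assoc, gen_mul_gen, mul_one]

theorem gen_injective : Function.Injective gen := by decide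

theorem gen_ne_one : ∀ c, gen c ≠ 1 := by decide

@[simp] theorem mul_gen_inj {v : FreeInvolutions} {c d : Option Bool} :
    v * gen c = v * gen d ↔ c = d := by
  rw [mul_right_inj, gen_injective.eq_iff]

@[elab_as_elim]
theorem gen_induction {P : FreeInvolutions → Prop} (one : P 1)
    (mul : ∀ v c, P v → P (v * gen c)) (v : FreeInvolutions) : P v :=
  step_induction one (fun v c h => mul_gen v c ▸ mul v c h) v

theorem lift_mul_gen {Z : Type*} {ρ : Option Bool → Z → Z} (hρ : ∀ c z, ρ c (ρ c z) = z) (z : Z)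
    (v : FreeInvolutions) (c : Option Bool) : lift ρ z (v * gen c) = ρ c (lift ρ z v) := by
  rw [mul_gen, lift_step hρ]

/-- The Cayley graph of the free product. -/
def cayley : SimpleGraph FreeInvolutions where
  Adj v w := ∃ c, w = v * gen c
  symm := ⟨by
    rintro v w ⟨c, rfl⟩
    exact ⟨c, by simp⟩⟩
  loopless := ⟨by
    rintro v ⟨c, h⟩
    exact gen_ne_one c (by simpa using h.symm)⟩

theorem cayley_adj {v w : FreeInvolutions} : cayley.Adj v w ↔ ∃ c, w = v * gen c := Iff.rfl

instance : DecidableRel cayley.Adj := fun _ _ => decidable_of_iff _ cayley_adj.symm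

theorem cayley_adj_mul_left (u : FreeInvolutions) {v w : FreeInvolutions} :
    cayley.Adj (u * v) (u * w) ↔ cayley.Adj v w := by
  simp only [cayley_adj, mul_assoc, mul_right_inj]

theorem cayley_adj_mul_gen (v : FreeInvolutions) (c : Option Bool) : cayley.Adj v (v * gen c) :=
  ⟨c, rfl⟩

theorem cayley_connected : cayley.Connected := by
  have key : ∀ v, cayley.Reachable 1 v := by
    intro v
    induction v using gen_induction with
    | one => exact SimpleGraph.Reachable.refl _
    | mul v c ih => exact ih.trans (cayley_adj_mul_gen v c).reachable
  exact ⟨fun v w => (key v).symm.trans (key w)⟩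

/-- The words that begin with `v.step c` (as lists: have it as a suffix) form one side of the edge.
A walk avoiding the edge cannot leave this side, and `v` is too short to belong to it. -/
theorem cayley_isBridge {v : FreeInvolutions} {c : Option Bool} (h : v.1.head? ≠ some c) :
    cayley.IsBridge s(v, v.step c) := by
  rw [SimpleGraph.isBridge_iff]
  intro hr
  obtain ⟨p⟩ := hr.symm
  have key : ∀ (x y : FreeInvolutions) (_ : (cayley.deleteEdges {s(v, v.step c)}).Walk x y),
      (v.step c).1 <:+ x.1 → (v.step c).1 <:+ y.1 := by
    intro x y q
    induction q with
    | nil => exact id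
    | @cons x y z hxy q ih =>
      refine fun hx => ih ?_
      rw [SimpleGraph.deleteEdges_adj] at hxy
      obtain ⟨⟨d, rfl⟩, hne⟩ := hxy
      rw [mul_gen] at hne ⊢
      by_cases hd : x.1.head? = some d
      · rw [step_of_head_eq hd]
        rcases x with ⟨_ | ⟨a, t⟩, hx'⟩
        · simp at hd
        · rcases List.suffix_cons_iff.1 hx with h1 | h1
          · exfalso
            apply hne
            have hx1 : v.step c = ⟨a :: t, hx'⟩ := Subtype.ext h1
            have : a = c := by
              rw [step_of_head_ne h] at h1
              exact (List.cons.inj h1).1.symm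
            obtain rfl : a = d := by simpa using hd
            subst this
            rw [← hx1, step_step]
            exact Sym2.eq_swap
          · exact h1
      · rw [step_of_head_ne hd]
        exact hx.trans (List.suffix_cons _ _)
  have := (key _ _ p (List.suffix_refl _)).length_le
  rw [step_of_head_ne h] at this
  simp at this

theorem cayley_isTree : cayley.IsTree := by
  refine ⟨cayley_connected, SimpleGraph.isAcyclic_iff_forall_adj_isBridge.2 ?_⟩
  rintro v w ⟨c, rfl⟩
  by_cases h : v.1.head? = some c
  · have h1 : (v.step c).1.head? ≠ some c := by
      rw [step_of_head_eq h]
      rcases v with ⟨_ | ⟨a, _ | ⟨b, t⟩⟩, hv⟩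
      · simp
      · simp
      · obtain rfl : a = c := by simpa using h
        simpa using (List.isChain_cons_cons.1 hv).1.symm
    have := cayley_isBridge h1
    rwa [step_step, Sym2.eq_swap, ← mul_gen] at this
  · rw [mul_gen]
    exact cayley_isBridge h

/-- The generator `some b` is changed to `some (!b)` if `s` is true. -/
def flip (s : Bool) (c : Option Bool) : Option Bool := c.map (xor s)

end FreeInvolutions

/-! ### Cubical automorphisms of a general tree with fins. -/

namespace TreeWithFins

variable {X : TreeWithFins}

/-- The vertex of the underlying tree below a vertex of a fin. -/
def base (X : TreeWithFins) (a : Σ i, X.Y i) : X.V := X.γ a.1 a.2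

/-- Adjacency of vertices of fins. -/
def FinAdj (X : TreeWithFins) (a b : Σ i, X.Y i) : Prop :=
  ∃ i y z, (X.fin i).Adj y z ∧ a = ⟨i, y⟩ ∧ b = ⟨i, z⟩

theorem isCell_iff {c : Set X.Vert} : X.IsCell c ↔
    (∃ v, c = {v}) ∨ (∃ v w, X.tree.Adj v w ∧ c = {Sum.inl v, Sum.inl w}) ∨
    (∃ a b, X.FinAdj a b ∧ c = {Sum.inr a, Sum.inr b}) ∨
    (∃ a, c = {Sum.inl (X.base a), Sum.inr a}) ∨
    (∃ a b, X.FinAdj a b ∧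
      c = {Sum.inl (X.base a), Sum.inl (X.base b), Sum.inr a, Sum.inr b}) := by
  constructor
  · rintro (v | ⟨i, y⟩ | ⟨v, w, h⟩ | ⟨i, y, z, h⟩ | ⟨i, y⟩ | ⟨i, y, z, h⟩)
    · exact Or.inl ⟨_, rfl⟩
    · exact Or.inl ⟨_, rfl⟩
    · exact Or.inr (Or.inl ⟨v, w, h, rfl⟩)
    · exact Or.inr (Or.inr (Or.inl ⟨_, _, ⟨i, y, z, h, rfl, rfl⟩, rfl⟩))
    · exact Or.inr (Or.inr (Or.inr (Or.inl ⟨⟨i, y⟩, rfl⟩)))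
    · exact Or.inr (Or.inr (Or.inr (Or.inr ⟨_, _, ⟨i, y, z, h, rfl, rfl⟩, rfl⟩)))
  · rintro (⟨v | ⟨i, y⟩, rfl⟩ | ⟨v, w, h, rfl⟩ | ⟨_, _, ⟨i, y, z, h, rfl, rfl⟩, rfl⟩ |
      ⟨⟨i, y⟩, rfl⟩ | ⟨_, _, ⟨i, y, z, h, rfl, rfl⟩, rfl⟩)
    · exact .treeVertex v
    · exact .finVertex i y
    · exact .treeEdge v w h
    · exact .finEdge i y z h
    · exact .verticalEdge i y
    · exact .square i y z h

theorem FinAdj.ne {a b : Σ i, X.Y i} (h : X.FinAdj a b) : a ≠ b := by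
  obtain ⟨i, y, z, h, rfl, rfl⟩ := h
  intro e
  exact h.ne (by simpa using e)

theorem FinAdj.symm {a b : Σ i, X.Y i} (h : X.FinAdj a b) : X.FinAdj b a := by
  obtain ⟨i, y, z, h, rfl, rfl⟩ := h
  exact ⟨i, z, y, h.symm, rfl, rfl⟩

/-- This and the two following lemmas recover the three kinds of edges from the two-element cells,
so that an automorphism preserves each kind. -/
theorem isCell_tree_pair {v w : X.V} (hne : v ≠ w) :
    X.IsCell {Sum.inl v, Sum.inl w} ↔ X.tree.Adj v w := by
  refine ⟨fun h => ?_, fun h => .treeEdge v w h⟩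
  rcases isCell_iff.1 h with ⟨x, h⟩ | ⟨x, y, hxy, h⟩ | ⟨a, b, -, h⟩ | ⟨a, h⟩ | ⟨a, b, -, h⟩
  · have h1 : Sum.inl v = x := by simpa using h.subset (Set.mem_insert _ _)
    have h2 : Sum.inl w = x := by simpa using h.subset (Set.mem_insert_of_mem _ rfl)
    exact absurd (Sum.inl_injective (h1.trans h2.symm)) hne
  · have h1 : v = x ∨ v = y := by simpa using h.subset (Set.mem_insert _ _)
    have h2 : w = x ∨ w = y := by simpa using h.subset (Set.mem_insert_of_mem _ rfl)
    rcases h1 with rfl | rfl <;> rcases h2 with rfl | rfl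
    · exact absurd rfl hne
    · exact hxy
    · exact hxy.symm
    · exact absurd rfl hne
  · have : (Sum.inr a : X.Vert) ∈ ({Sum.inl v, Sum.inl w} : Set X.Vert) := by simp [h]
    simp at this
  · have : (Sum.inr a : X.Vert) ∈ ({Sum.inl v, Sum.inl w} : Set X.Vert) := by simp [h]
    simp at this
  · have : (Sum.inr a : X.Vert) ∈ ({Sum.inl v, Sum.inl w} : Set X.Vert) := by simp [h]
    simp at this

theorem isCell_fin_pair {a b : Σ i, X.Y i} (hne : a ≠ b) :
    X.IsCell {Sum.inr a, Sum.inr b} ↔ X.FinAdj a b := by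
  refine ⟨fun h => ?_, fun h => isCell_iff.2 (Or.inr (Or.inr (Or.inl ⟨a, b, h, rfl⟩)))⟩
  rcases isCell_iff.1 h with ⟨x, h⟩ | ⟨x, y, -, h⟩ | ⟨x, y, hxy, h⟩ | ⟨x, h⟩ | ⟨x, y, -, h⟩
  · have h1 : Sum.inr a = x := by simpa using h.subset (Set.mem_insert _ _)
    have h2 : Sum.inr b = x := by simpa using h.subset (Set.mem_insert_of_mem _ rfl)
    exact absurd (Sum.inr_injective (h1.trans h2.symm)) hne
  · have : (Sum.inl x : X.Vert) ∈ ({Sum.inr a, Sum.inr b} : Set X.Vert) := by simp [h]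
    simp at this
  · have h1 : a = x ∨ a = y := by
      simpa only [Set.mem_insert_iff, Set.mem_singleton_iff, Sum.inr.injEq] using
        h.subset (Set.mem_insert _ _)
    have h2 : b = x ∨ b = y := by
      simpa only [Set.mem_insert_iff, Set.mem_singleton_iff, Sum.inr.injEq] using
        h.subset (Set.mem_insert_of_mem _ rfl)
    rcases h1 with rfl | rfl <;> rcases h2 with rfl | rfl
    · exact absurd rfl hne
    · exact hxy
    · exact hxy.symm
    · exact absurd rfl hne
  · have : (Sum.inl (X.base x) : X.Vert) ∈ ({Sum.inr a, Sum.inr b} : Set X.Vert) := by simp [h]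
    simp at this
  · have : (Sum.inl (X.base x) : X.Vert) ∈ ({Sum.inr a, Sum.inr b} : Set X.Vert) := by simp [h]
    simp at this

theorem isCell_vertical_pair {v : X.V} {a : Σ i, X.Y i} :
    X.IsCell {Sum.inl v, Sum.inr a} ↔ v = X.base a := by
  refine ⟨fun h => ?_, fun h => isCell_iff.2 (Or.inr (Or.inr (Or.inr (Or.inl ⟨a, by rw [h]⟩))))⟩
  rcases isCell_iff.1 h with ⟨x, h⟩ | ⟨x, y, -, h⟩ | ⟨x, y, -, h⟩ | ⟨x, h⟩ | ⟨x, y, hxy, h⟩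
  · have h1 : Sum.inl v = x := by simpa using h.subset (Set.mem_insert _ _)
    have h2 : Sum.inr a = x := by simpa using h.subset (Set.mem_insert_of_mem _ rfl)
    simpa using h1.trans h2.symm
  · have := h.subset (Set.mem_insert_of_mem _ rfl)
    simp at this
  · have := h.subset (Set.mem_insert _ _)
    simp at this
  · have h1 : v = X.base x := by simpa using h.subset (Set.mem_insert _ _)
    have h2 : a = x := by
      simpa only [Set.mem_insert_iff, Set.mem_singleton_iff, Sum.inr.injEq, reduceCtorEq,
        false_or] using h.subset (Set.mem_insert_of_mem _ rfl)
    rw [h1, h2]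
  · have h1 : Sum.inr x ∈ ({Sum.inl v, Sum.inr a} : Set X.Vert) := by simp [h]
    have h2 : Sum.inr y ∈ ({Sum.inl v, Sum.inr a} : Set X.Vert) := by simp [h]
    simp only [Set.mem_insert_iff, Set.mem_singleton_iff, Sum.inr.injEq, reduceCtorEq,
        false_or] at h1 h2
    exact absurd (h1.trans h2.symm) hxy.ne

/-- The cubical automorphism given by an automorphism of the underlying tree and a compatible
permutation of the vertices of the fins. -/
theorem sumCongr_mem_Aut (h : Equiv.Perm X.V) (k : Equiv.Perm (Σ i, X.Y i))
    (hh : ∀ v w, X.tree.Adj (h v) (h w) ↔ X.tree.Adj v w)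
    (hk : ∀ a b, X.FinAdj (k a) (k b) ↔ X.FinAdj a b)
    (hb : ∀ a, X.base (k a) = h (X.base a)) :
    (Equiv.sumCongr h k : Equiv.Perm X.Vert) ∈ X.Aut := by
  -- Quantified afresh over `h` and `k` so as to apply to the inverses as well.
  have fwd : ∀ (h : Equiv.Perm X.V) (k : Equiv.Perm (Σ i, X.Y i))
      (_ : ∀ v w, X.tree.Adj (h v) (h w) ↔ X.tree.Adj v w)
      (_ : ∀ a b, X.FinAdj (k a) (k b) ↔ X.FinAdj a b)
      (_ : ∀ a, X.base (k a) = h (X.base a)) (c : Set X.Vert),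
      X.IsCell c → X.IsCell ((Equiv.sumCongr h k : Equiv.Perm X.Vert) '' c) := by
    intro h k hh hk hb c hc
    rcases isCell_iff.1 hc with ⟨x, rfl⟩ | ⟨x, y, hxy, rfl⟩ | ⟨x, y, hxy, rfl⟩ | ⟨x, rfl⟩ |
      ⟨x, y, hxy, rfl⟩ <;>
      simp only [Set.image_insert_eq, Set.image_singleton, Equiv.sumCongr_apply, Sum.map_inl,
        Sum.map_inr]
    · exact isCell_iff.2 (Or.inl ⟨_, rfl⟩)
    · exact isCell_iff.2 (Or.inr (Or.inl ⟨_, _, (hh _ _).2 hxy, rfl⟩))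
    · exact isCell_iff.2 (Or.inr (Or.inr (Or.inl ⟨_, _, (hk _ _).2 hxy, rfl⟩)))
    · rw [← hb]
      exact isCell_iff.2 (Or.inr (Or.inr (Or.inr (Or.inl ⟨_, rfl⟩))))
    · rw [← hb, ← hb]
      exact isCell_iff.2 (Or.inr (Or.inr (Or.inr (Or.inr ⟨_, _, (hk _ _).2 hxy, rfl⟩))))
  refine ⟨fun c => ⟨fun hc => ?_, fwd h k hh hk hb c⟩, ?_⟩
  · have := fwd h.symm k.symm (fun v w => by rw [← hh]; simp) (fun v w => by rw [← hk]; simp)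
      (fun a => by rw [Equiv.eq_symm_apply, ← hb]; simp) _ hc
    rw [← Equiv.sumCongr_symm, Equiv.symm_image_image] at this
    exact this
  · ext x
    simp only [Set.mem_image, Set.mem_range, onTree, exists_exists_eq_and, Equiv.sumCongr_apply,
      Sum.map_inl]
    exact ⟨fun ⟨a, e⟩ => ⟨h a, e⟩, fun ⟨a, e⟩ => ⟨h.symm a, by simpa using e⟩⟩

theorem exists_onTree (g : X.Aut) (v : X.V) :
    ∃ w, (g : Equiv.Perm X.Vert) (Sum.inl v) = Sum.inl w := by
  have : (g : Equiv.Perm X.Vert) (Sum.inl v) ∈ Set.range X.onTree :=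
    g.2.2 ▸ Set.mem_image_of_mem _ ⟨v, rfl⟩
  obtain ⟨w, hw⟩ := this
  exact ⟨w, hw.symm⟩

theorem exists_onFin (g : X.Aut) (a : Σ i, X.Y i) :
    ∃ b, (g : Equiv.Perm X.Vert) (Sum.inr a) = Sum.inr b := by
  rcases h : (g : Equiv.Perm X.Vert) (Sum.inr a) with v | b
  · have : (g : Equiv.Perm X.Vert) (Sum.inr a) ∈
      (g : Equiv.Perm X.Vert) '' Set.range X.onTree := by
      rw [g.2.2]
      exact ⟨v, h.symm⟩
    obtain ⟨_, ⟨w, rfl⟩, hw⟩ := this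
    exact absurd ((g : Equiv.Perm X.Vert).injective hw) (by simp [onTree])
  · exact ⟨b, rfl⟩

/-- The action of an automorphism on the vertices of the underlying tree. -/
noncomputable def onV (g : X.Aut) (v : X.V) : X.V := (exists_onTree g v).choose

theorem apply_inl (g : X.Aut) (v : X.V) :
    (g : Equiv.Perm X.Vert) (Sum.inl v) = Sum.inl (onV g v) := (exists_onTree g v).choose_spec

/-- The action of an automorphism on the vertices of the fins. -/
noncomputable def onE (g : X.Aut) (a : Σ i, X.Y i) : Σ i, X.Y i := (exists_onFin g a).choose

theorem apply_inr (g : X.Aut) (a : Σ i, X.Y i) :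
    (g : Equiv.Perm X.Vert) (Sum.inr a) = Sum.inr (onE g a) := (exists_onFin g a).choose_spec

theorem onV_mul (g h : X.Aut) (v : X.V) : onV (g * h) v = onV g (onV h v) := by
  apply Sum.inl_injective (β := Σ i, X.Y i)
  rw [← apply_inl, Subgroup.coe_mul, Equiv.Perm.mul_apply, apply_inl, apply_inl]

theorem onV_one (v : X.V) : onV (1 : X.Aut) v = v := by
  apply Sum.inl_injective (β := Σ i, X.Y i)
  rw [← apply_inl, Subgroup.coe_one, Equiv.Perm.one_apply]

theorem onE_mul (g h : X.Aut) (v : Σ i, X.Y i) : onE (g * h) v = onE g (onE h v) := by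
  apply Sum.inr_injective (α := X.V)
  rw [← apply_inr, Subgroup.coe_mul, Equiv.Perm.mul_apply, apply_inr, apply_inr]

theorem onE_one (v : Σ i, X.Y i) : onE (1 : X.Aut) v = v := by
  apply Sum.inr_injective (α := X.V)
  rw [← apply_inr, Subgroup.coe_one, Equiv.Perm.one_apply]

theorem onV_injective (g : X.Aut) : Function.Injective (onV g) :=
  Function.LeftInverse.injective (g := onV g⁻¹) fun v => by
    rw [← onV_mul, inv_mul_cancel, onV_one]

theorem onE_injective (g : X.Aut) : Function.Injective (onE g) :=
  Function.LeftInverse.injective (g := onE g⁻¹) fun v => by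
    rw [← onE_mul, inv_mul_cancel, onE_one]

theorem tree_adj_onV (g : X.Aut) {v w : X.V} (h : X.tree.Adj v w) :
    X.tree.Adj (onV g v) (onV g w) := by
  rw [← isCell_tree_pair ((onV_injective g).ne h.ne), ← apply_inl, ← apply_inl,
    ← Set.image_pair, g.2.1]
  exact .treeEdge v w h

theorem finAdj_onE (g : X.Aut) {v w : Σ i, X.Y i} (h : X.FinAdj v w) :
    X.FinAdj (onE g v) (onE g w) := by
  rw [← isCell_fin_pair ((onE_injective g).ne h.ne), ← apply_inr, ← apply_inr,
    ← Set.image_pair, g.2.1]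
  exact (isCell_fin_pair h.ne).2 h

theorem onV_base (g : X.Aut) (a : Σ i, X.Y i) : onV g (X.base a) = X.base (onE g a) := by
  rw [← isCell_vertical_pair, ← apply_inl, ← apply_inr, ← Set.image_pair, g.2.1]
  exact isCell_vertical_pair.2 rfl

/-- An automorphism takes a fin into a fin. -/
theorem onE_fst (g : X.Aut) {i : X.ι} (y z : X.Y i) :
    (onE g ⟨i, y⟩).1 = (onE g ⟨i, z⟩).1 := by
  obtain ⟨p⟩ := (X.fin_isTree i).connected.preconnected y z
  induction p with
  | nil => rfl
  | cons h _ ih =>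
    rw [← ih]
    obtain ⟨j, a, b, -, ha, hb⟩ := finAdj_onE g ⟨i, _, _, h, rfl, rfl⟩
    rw [ha, hb]

theorem exists_fin_map (g : X.Aut) (i : X.ι) : ∃ (j : X.ι) (f : X.Y i → X.Y j),
    (∀ y, onE g ⟨i, y⟩ = ⟨j, f y⟩) ∧ Function.Injective f ∧
    (∀ y z, (X.fin i).Adj y z → (X.fin j).Adj (f y) (f z)) ∧
    ∀ y, onV g (X.γ i y) = X.γ j (f y) := by
  obtain ⟨y₀⟩ := (X.fin_isTree i).connected.nonempty
  set j := (onE g ⟨i, y₀⟩).1 with hj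
  have key : ∀ y, ∃ z : X.Y j, onE g ⟨i, y⟩ = ⟨j, z⟩ := by
    intro y
    have := onE_fst g y y₀
    rw [← hj] at this
    generalize onE g ⟨i, y⟩ = b at this
    clear_value j
    subst this
    exact ⟨b.2, rfl⟩
  choose f hf using key
  refine ⟨j, f, hf, fun y z h => ?_, fun y z h => ?_, fun y => ?_⟩
  · have := onE_injective g ((hf y).trans ((congrArg _ h).trans (hf z).symm))
    simpa using this
  · obtain ⟨l, a, b, hab, ha, hb⟩ := finAdj_onE g ⟨i, _, _, h, rfl, rfl⟩
    rw [hf] at ha hb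
    cases ha
    cases hb
    exact hab
  · have := onV_base g ⟨i, y⟩
    rw [hf] at this
    exact this

/-- The inverse automorphism brings fin `j` back into fin `i`, so the injection of fins is onto. In
particular fins of different sizes are never exchanged. -/
theorem exists_fin_equiv (g : X.Aut) (i : X.ι) : ∃ (j : X.ι) (f : X.Y i ≃ X.Y j),
    (∀ y, onE g ⟨i, y⟩ = ⟨j, f y⟩) ∧
    (∀ y z, (X.fin i).Adj y z → (X.fin j).Adj (f y) (f z)) ∧
    ∀ y, onV g (X.γ i y) = X.γ j (f y) := by
  obtain ⟨j, f, hf, hinj, hadj, hγ⟩ := exists_fin_map g i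
  obtain ⟨i', f', hf', -⟩ := exists_fin_map g⁻¹ j
  obtain ⟨y₀⟩ := (X.fin_isTree i).connected.nonempty
  have inv : ∀ a, onE g (onE g⁻¹ a) = a := fun a => by
    rw [← onE_mul, mul_inv_cancel, onE_one]
  have h0 : (⟨i, y₀⟩ : Σ i, X.Y i) = ⟨i', f' (f y₀)⟩ := by
    rw [← hf', ← hf, ← onE_mul, inv_mul_cancel, onE_one]
  obtain rfl : i = i' := congrArg Sigma.fst h0
  refine ⟨j, Equiv.ofBijective f ⟨hinj, fun z => ⟨f' z, ?_⟩⟩, hf, hadj, hγ⟩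
  have := inv ⟨j, z⟩
  rw [hf', hf] at this
  simpa using this

/-- An automorphism fixing a vertex permutes the edges at this vertex. -/
theorem exists_induces (x : X.V) (g : X.Aut) (hg : g • X.onTree x = X.onTree x) :
    ∃ π, X.Induces x g π := by
  have hx : ∀ g : X.Aut, g • X.onTree x = X.onTree x →
      ∀ e ∈ X.edgesAt x, (g : Equiv.Perm X.Vert) '' e ∈ X.edgesAt x := by
    rintro g hg _ ⟨w, hw, rfl⟩
    have hv : onV g x = x := by
      have := apply_inl g x
      exact Sum.inl_injective (this.symm.trans hg)
    refine ⟨onV g w, ?_, ?_⟩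
    · have := tree_adj_onV g hw
      rwa [hv] at this
    · simp only [onTree]
      rw [Set.image_pair, apply_inl, apply_inl, hv]
  have hg' : g⁻¹ • X.onTree x = X.onTree x := by rw [inv_smul_eq_iff, hg]
  refine ⟨⟨fun e => ⟨_, hx g hg e e.2⟩, fun e => ⟨_, hx g⁻¹ hg' e e.2⟩, fun e => ?_, fun e => ?_⟩,
    hg, fun e => rfl⟩
  · apply Subtype.ext
    simp only [← Set.image_comp, ← Equiv.Perm.coe_mul, ← Subgroup.coe_mul]
    simp
  · apply Subtype.ext
    simp only [← Set.image_comp, ← Equiv.Perm.coe_mul, ← Subgroup.coe_mul]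
    simp

/-- A tree with fins is locally finite if its underlying tree is, and if every vertex of the
underlying tree lies below finitely many vertices of fins. -/
theorem locallyFinite_of_finite (h : ∀ v, {w | X.tree.Adj v w}.Finite)
    (h' : ∀ v, {a | X.base a = v}.Finite) : X.LocallyFinite := by
  intro v
  -- Collapsing the fins onto the tree sends every cell through `v` into the closed 1-neighbourhood
  -- of `p v`.
  let p : X.Vert → X.V := Sum.elim id X.base
  let N : Set X.V := insert (p v) {w | X.tree.Adj (p v) w}
  have hN : N.Finite := (h _).insert _
  have hfib : ∀ w, (p ⁻¹' {w}).Finite := by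
    intro w
    refine (((Set.finite_singleton w).image Sum.inl).union ((h' w).image Sum.inr)).subset ?_
    rintro (x | a) hx
    · exact Or.inl ⟨x, hx, rfl⟩
    · exact Or.inr ⟨a, hx, rfl⟩
  have hM : (p ⁻¹' N).Finite := by
    rw [← Set.biUnion_preimage_singleton]
    exact hN.biUnion fun w _ => hfib w
  refine hM.finite_subsets.subset ?_
  rintro c ⟨hc, hv⟩ w hw
  have hadj : ∀ a b, X.FinAdj a b → X.tree.Adj (X.base a) (X.base b) := by
    rintro _ _ ⟨i, y, z, h, rfl, rfl⟩
    exact (X.γ i).map_rel_iff.2 h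
  suffices p w = p v ∨ X.tree.Adj (p v) (p w) from this
  rcases isCell_iff.1 hc with ⟨x, rfl⟩ | ⟨x, y, hxy, rfl⟩ | ⟨x, y, hxy, rfl⟩ | ⟨x, rfl⟩ |
    ⟨x, y, hxy, rfl⟩
  · simp only [Set.mem_singleton_iff] at hv hw
    simp [hv, hw]
  · rcases hv with rfl | rfl <;> rcases hw with rfl | rfl <;> simp [p, hxy, hxy.symm]
  · have := hadj _ _ hxy
    rcases hv with rfl | rfl <;> rcases hw with rfl | rfl <;> simp [p, this, this.symm]
  · rcases hv with rfl | rfl <;> rcases hw with rfl | rfl <;> simp [p]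
  · have := hadj _ _ hxy
    rcases hv with rfl | rfl | rfl | rfl <;> rcases hw with rfl | rfl | rfl | rfl <;>
      simp [p, this, this.symm]

end TreeWithFins

/-! ### The short and long fins. -/

namespace FreeInvolutions

open SimpleGraph

/-- By injectivity the image path never turns back, so the direction of its first step persists;
eight vertices leave room only for the identity and the reversal. -/
theorem pathGraph_rigid {f : Fin 8 → Fin 8} (hf : Function.Injective f)
    (hadj : ∀ y z, (pathGraph 8).Adj y z → (pathGraph 8).Adj (f y) (f z)) :
    (∀ k, f k = k) ∨ ∀ k, f k = Fin.rev k := by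
  have h1 : ∀ k l : Fin 8, k.val + 1 = l.val →
      (f k).val + 1 = (f l).val ∨ (f l).val + 1 = (f k).val := fun k l h => by
    simpa only [pathGraph_adj] using hadj k l (by simp [pathGraph_adj, h])
  have h2 : ∀ k l : Fin 8, k.val ≠ l.val → (f k).val ≠ (f l).val := fun k l h e =>
    h (congrArg Fin.val (hf (Fin.ext e)))
  have a0 := h1 0 1 rfl
  have a1 := h1 1 2 rfl
  have a2 := h1 2 3 rfl
  have a3 := h1 3 4 rfl
  have a4 := h1 4 5 rfl
  have a5 := h1 5 6 rfl
  have a6 := h1 6 7 rfl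
  have b0 := h2 0 2 (by decide)
  have b1 := h2 1 3 (by decide)
  have b2 := h2 2 4 (by decide)
  have b3 := h2 3 5 (by decide)
  have b4 := h2 4 6 (by decide)
  have b5 := h2 5 7 (by decide)
  have c0 := (f 0).isLt
  have c7 := (f 7).isLt
  rcases a0 with a0 | a0
  · replace a1 := a1.resolve_right fun h => b0 (Nat.succ_injective (a0.trans h.symm))
    replace a2 := a2.resolve_right fun h => b1 (Nat.succ_injective (a1.trans h.symm))
    replace a3 := a3.resolve_right fun h => b2 (Nat.succ_injective (a2.trans h.symm))
    replace a4 := a4.resolve_right fun h => b3 (Nat.succ_injective (a3.trans h.symm))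
    replace a5 := a5.resolve_right fun h => b4 (Nat.succ_injective (a4.trans h.symm))
    replace a6 := a6.resolve_right fun h => b5 (Nat.succ_injective (a5.trans h.symm))
    clear h1 h2 b0 b1 b2 b3 b4 b5
    left
    intro k
    fin_cases k <;> simp only [Fin.ext_iff] <;> simp <;> omega
  · replace a1 := a1.resolve_left fun h => b0 (a0.symm.trans h)
    replace a2 := a2.resolve_left fun h => b1 (a1.symm.trans h)
    replace a3 := a3.resolve_left fun h => b2 (a2.symm.trans h)
    replace a4 := a4.resolve_left fun h => b3 (a3.symm.trans h)
    replace a5 := a5.resolve_left fun h => b4 (a4.symm.trans h)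
    replace a6 := a6.resolve_left fun h => b5 (a5.symm.trans h)
    clear h1 h2 b0 b1 b2 b3 b4 b5
    right
    intro k
    fin_cases k <;> simp only [Fin.ext_iff, Fin.rev] <;> simp <;> omega

/-- The index set of the fins. -/
abbrev FinIndex : Type := FreeInvolutions ⊕ (FreeInvolutions × Bool × Bool)

/-- The number of vertices of a fin. -/
def size : FinIndex → ℕ
  | .inl _ => 2
  | .inr _ => 8

/-- The first vertex of a fin. -/
def origin : FinIndex → FreeInvolutions
  | .inl v => v
  | .inr x => x.1

/-- The path of length one with label `none`. -/
def shortPath : Fin 2 → FreeInvolutions := ![1, gen none]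

/-- The path of length seven whose edges are labelled
`some a, none, some b, some !b, none, some c, some !c`, where `c` is the sum of `a` and `b`. -/
def longPath (a b : Bool) : Fin 8 → FreeInvolutions :=
  ![1,
    gen (some a),
    gen (some a) * gen none,
    gen (some a) * gen none * gen (some b),
    gen (some a) * gen none * gen (some b) * gen (some !b),
    gen (some a) * gen none * gen (some b) * gen (some !b) * gen none,
    gen (some a) * gen none * gen (some b) * gen (some !b) * gen none * gen (some (xor a b)),
    gen (some a) * gen none * gen (some b) * gen (some !b) * gen none * gen (some (xor a b)) *
      gen (some !(xor a b))]

/-- The translate of a fin which starts at the identity. -/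
def shape : (i : FinIndex) → Fin (size i) → FreeInvolutions
  | .inl _ => shortPath
  | .inr x => longPath x.2.1 x.2.2

theorem length_shortPath : ∀ k, (shortPath k).1.length = k := by decide

theorem length_longPath : ∀ a b k, (longPath a b k).1.length = k := by decide +kernel

/-- With the vertex of index `k` on a fin having word length `k`, this shows that the fins are
induced paths. -/
theorem length_of_adj {v w : FreeInvolutions} (h : cayley.Adj v w) :
    v.1.length + 1 = w.1.length ∨ w.1.length + 1 = v.1.length := by
  obtain ⟨c, rfl⟩ := h
  rw [mul_gen]
  by_cases hc : v.1.head? = some c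
  · right
    rw [step_of_head_eq hc, List.length_tail, Nat.sub_add_cancel]
    exact List.length_pos_iff.2 fun e => by simp [e] at hc
  · left
    rw [step_of_head_ne hc, List.length_cons]

theorem shortPath_adj (k l : Fin 2) :
    cayley.Adj (shortPath k) (shortPath l) ↔ (pathGraph 2).Adj k l := by
  rw [pathGraph_adj]
  have key : ∀ k l : Fin 2, k.val + 1 = l.val → cayley.Adj (shortPath k) (shortPath l) := by
    intro k l h
    obtain rfl : k = 0 := by omega
    obtain rfl : l = 1 := by omega
    exact ⟨none, rfl⟩
  refine ⟨fun h => ?_, fun h => h.elim (key k l) fun h => (key l k h).symm⟩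
  simpa only [length_shortPath] using length_of_adj h

theorem longPath_adj (a b : Bool) (k l : Fin 8) :
    cayley.Adj (longPath a b k) (longPath a b l) ↔ (pathGraph 8).Adj k l := by
  rw [pathGraph_adj]
  have key : ∀ k l : Fin 8, k.val + 1 = l.val →
      cayley.Adj (longPath a b k) (longPath a b l) := by
    intro k l h
    obtain ⟨k, hk⟩ := k
    obtain ⟨l, hl⟩ := l
    obtain rfl : k + 1 = l := h
    have hk' : k < 7 := by omega
    interval_cases k
    · exact cayley_adj_mul_gen 1 (some a)
    all_goals exact cayley_adj_mul_gen _ _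
  refine ⟨fun h => ?_, fun h => h.elim (key k l) fun h => (key l k h).symm⟩
  simpa only [length_longPath] using length_of_adj h

theorem shortPath_injective : Function.Injective shortPath := fun k l h =>
  Fin.ext (by rw [← length_shortPath, h, length_shortPath])

theorem longPath_injective (a b : Bool) : Function.Injective (longPath a b) := fun k l h =>
  Fin.ext (by rw [← length_longPath a b, h, length_longPath])

/-- The embedding of a fin into the tree. -/
def attach (i : FinIndex) : pathGraph (size i) ↪g cayley where
  toFun k := origin i * shape i k
  inj' := by
    rcases i with v | ⟨x, a, b⟩
    · exact (mul_right_injective _).comp shortPath_injective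
    · exact (mul_right_injective _).comp (longPath_injective a b)
  map_rel_iff' := by
    intro k l
    simp only [Function.Embedding.coeFn_mk, cayley_adj_mul_left]
    rcases i with v | ⟨x, a, b⟩
    · exact shortPath_adj k l
    · exact longPath_adj a b k l

/-- The tree with fins given by the short and long paths starting at all the vertices of the Cayley
graph. -/
def finned : TreeWithFins where
  V := FreeInvolutions
  tree := cayley
  isTree := cayley_isTree
  ι := FinIndex
  Y i := Fin (size i)
  fin i := pathGraph (size i)
  fin_isTree i := by
    refine ⟨?_, IsAcyclic.comap (attach i).toHom (attach i).injective cayley_isTree.isAcyclic⟩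
    rcases i with v | x
    · exact pathGraph_connected 1
    · exact pathGraph_connected 7
  γ := attach

open TreeWithFins

/-! ### Automorphisms built from label flips. -/

@[simp] theorem flip_none (s : Bool) : flip s none = none := rfl

@[simp] theorem flip_some (s b : Bool) : flip s (some b) = some (xor s b) := rfl

/-- A permutation of the vertices which, at every vertex `v`, either preserves the labels
of the edges or interchanges `some false` and `some true`, the latter if and only if `σ v`; on `σ`
we impose the conditions under which it maps fins to fins. -/
structure IsFlip (h : FreeInvolutions → FreeInvolutions) (σ : FreeInvolutions → Bool) :
    Prop where
  map_gen : ∀ v c, h (v * gen c) = h v * gen (flip (σ v) c)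
  sign_some : ∀ v b, σ (v * gen (some b)) = σ v
  sign_fin : ∀ v b, σ (v * gen (some b) * gen (some !b) * gen none) = xor (σ v) (σ (v * gen none))

/-- The permutation of the index set of the fins associated to an automorphism. -/
def indexMap (h : FreeInvolutions → FreeInvolutions) (σ : FreeInvolutions → Bool) :
    FinIndex → FinIndex
  | .inl v => .inl (h v)
  | .inr (x, a, b) => .inr (h x, xor (σ x) a, xor (σ (x * gen (some a) * gen none)) b)

theorem indexMap_bijective {h : FreeInvolutions → FreeInvolutions} (hh : Function.Bijective h)
    (σ : FreeInvolutions → Bool) : Function.Bijective (indexMap h σ) := by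
  constructor
  · rintro (v | ⟨x, a, b⟩) (w | ⟨y, c, d⟩) e
    · simp only [indexMap, Sum.inl.injEq] at e
      rw [hh.1 e]
    · simp [indexMap] at e
    · simp [indexMap] at e
    · simp only [indexMap, Sum.inr.injEq, Prod.mk.injEq] at e
      obtain ⟨e1, e2, e3⟩ := e
      obtain rfl := hh.1 e1
      obtain rfl : a = c := by simpa using e2
      obtain rfl : b = d := by simpa using e3
      rfl
  · rintro (v | ⟨x, a, b⟩)
    · obtain ⟨w, rfl⟩ := hh.2 v
      exact ⟨.inl w, rfl⟩
    · obtain ⟨x, rfl⟩ := hh.2 x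
      refine ⟨.inr (x, xor (σ x) a, xor (σ (x * gen (some (xor (σ x) a)) * gen none)) b), ?_⟩
      simp [indexMap]

/-- The permutation of the vertices of the fins associated to an automorphism. -/
def finMap (h : FreeInvolutions → FreeInvolutions) (σ : FreeInvolutions → Bool) :
    (Σ i, finned.Y i) → Σ i, finned.Y i
  | ⟨.inl v, k⟩ => ⟨indexMap h σ (.inl v), k⟩
  | ⟨.inr x, k⟩ => ⟨indexMap h σ (.inr x), k⟩

theorem finMap_fst (h : FreeInvolutions → FreeInvolutions) (σ : FreeInvolutions → Bool)
    (a : Σ i, finned.Y i) : (finMap h σ a).1 = indexMap h σ a.1 := by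
  rcases a with ⟨v | x, k⟩ <;> rfl

/-- The position of a vertex in its fin. -/
def pos (a : Σ i, finned.Y i) : ℕ := Fin.val (n := size a.1) a.2

theorem pos_finMap (h : FreeInvolutions → FreeInvolutions) (σ : FreeInvolutions → Bool)
    (a : Σ i, finned.Y i) : pos (finMap h σ a) = pos a := by
  rcases a with ⟨v | x, k⟩ <;> rfl

theorem finned_ext {a b : Σ i, finned.Y i} (h : a.1 = b.1)
    (h' : pos a = pos b) : a = b := by
  obtain ⟨i, k⟩ := a
  obtain ⟨j, l⟩ := b
  obtain rfl : i = j := h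
  exact congrArg _ (Fin.ext h')

theorem finned_locallyFinite : finned.LocallyFinite := by
  refine locallyFinite_of_finite (fun (v : FreeInvolutions) => ?_) fun (v : FreeInvolutions) => ?_
  · exact (Set.finite_range fun c => v * gen c).subset fun w ⟨c, hc⟩ => ⟨c, hc.symm⟩
  · have h1 : (Set.range fun k : Fin 2 =>
        (⟨Sum.inl (v * (shortPath k)⁻¹), k⟩ : Σ i, finned.Y i)).Finite := Set.finite_range _
    have h2 : (Set.range fun t : Bool × Bool × Fin 8 =>
        (⟨Sum.inr (v * (longPath t.1 t.2.1 t.2.2)⁻¹, t.1, t.2.1), t.2.2⟩ :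
          Σ i, finned.Y i)).Finite := Set.finite_range _
    refine (h1.union h2).subset ?_
    rintro ⟨w | ⟨x, a, b⟩, k⟩ hk
    · left
      refine ⟨k, ?_⟩
      have : w * shortPath k = v := hk
      subst this
      exact finned_ext (congrArg Sum.inl (mul_inv_cancel_right w _)) rfl
    · right
      refine ⟨(a, b, k), ?_⟩
      have : x * longPath a b k = v := hk
      subst this
      exact finned_ext (congrArg (fun y => Sum.inr (y, a, b)) (mul_inv_cancel_right x _)) rfl

theorem finAdj_iff {a b : Σ i, finned.Y i} : finned.FinAdj a b ↔ a.1 = b.1 ∧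
    (pos a + 1 = pos b ∨
      pos b + 1 = pos a) := by
  constructor
  · rintro ⟨i, y, z, h, rfl, rfl⟩
    exact ⟨rfl, pathGraph_adj.1 h⟩
  · obtain ⟨i, k⟩ := a
    obtain ⟨j, l⟩ := b
    rintro ⟨h, h'⟩
    obtain rfl : i = j := h
    exact ⟨i, k, l, pathGraph_adj.2 h', rfl, rfl⟩

theorem finMap_bijective {h : FreeInvolutions → FreeInvolutions} (hh : Function.Bijective h)
    (σ : FreeInvolutions → Bool) : Function.Bijective (finMap h σ) := by
  constructor
  · intro a b e
    refine finned_ext ((indexMap_bijective hh σ).1 ?_) ?_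
    · rw [← finMap_fst, ← finMap_fst, e]
    · rw [← pos_finMap h σ a, e, pos_finMap]
  · rintro ⟨i, k⟩
    obtain ⟨j, rfl⟩ := (indexMap_bijective hh σ).2 i
    rcases j with v | x
    · exact ⟨⟨.inl v, k⟩, rfl⟩
    · exact ⟨⟨.inr x, k⟩, rfl⟩

namespace IsFlip

variable {h : FreeInvolutions → FreeInvolutions} {σ : FreeInvolutions → Bool}

theorem adj_iff (H : IsFlip h σ) (hh : Function.Injective h) (v w : FreeInvolutions) :
    cayley.Adj (h v) (h w) ↔ cayley.Adj v w := by
  simp only [cayley_adj]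
  constructor
  · rintro ⟨c, hc⟩
    refine ⟨flip (σ v) c, hh ?_⟩
    rw [hc, H.map_gen]
    rcases c with _ | c <;> simp
  · rintro ⟨c, rfl⟩
    exact ⟨_, H.map_gen v c⟩

/-- On a long fin the labels `a`, `b`, `c` are shifted by the signs at positions 0, 2 and 5. By
`sign_fin` the third sign is the sum of the other two, so `c = a + b` survives and the image is
again a long fin. -/
theorem base_finMap (H : IsFlip h σ) (a : Σ i, finned.Y i) :
    finned.base (finMap h σ a) = h (finned.base a) := by
  rcases a with ⟨v | ⟨x, a, b⟩, k⟩
  · change h v * shortPath k = h (v * shortPath k)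
    have : ∀ k : Fin 2, h v * shortPath k = h (v * shortPath k) := by
      intro k
      fin_cases k
      · simp [shortPath]
      · simp [shortPath, H.map_gen]
    exact this k
  · change h x * longPath _ _ k = h (x * longPath a b k)
    have h1 : ∀ v, σ (v * gen (some b) * gen (some !b) * gen none) =
        xor (σ v) (σ (v * gen none)) := fun v => H.sign_fin v b
    have : ∀ k : Fin 8, h x * longPath (xor (σ x) a) (xor (σ (x * gen (some a) * gen none)) b)
        k = h (x * longPath a b k) := by
      intro k
      fin_cases k <;> simp [longPath, ← mul_assoc, H.map_gen, H.sign_some, h1]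
      all_goals
        generalize σ (x * gen (some a) * gen none) = t
        generalize σ x = s
        cases s <;> cases t <;> cases a <;> cases b <;> simp
    exact this k

/-- The automorphism of the tree with fins given by an automorphism of the tree. -/
noncomputable def toAut (H : IsFlip h σ) (hh : Function.Bijective h) : finned.Aut :=
  ⟨Equiv.sumCongr (Equiv.ofBijective h hh) (Equiv.ofBijective _ (finMap_bijective hh σ)),
    sumCongr_mem_Aut _ _ (fun v w => H.adj_iff hh.1 v w)
      (fun a b => by
        rw [finAdj_iff, finAdj_iff, Equiv.ofBijective_apply, Equiv.ofBijective_apply, finMap_fst,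
          finMap_fst, pos_finMap, pos_finMap]
        exact and_congr_left' (indexMap_bijective hh σ).1.eq_iff)
      (fun a => H.base_finMap a)⟩

theorem toAut_inl (H : IsFlip h σ) (hh : Function.Bijective h) (v : FreeInvolutions) :
    (H.toAut hh : Equiv.Perm finned.Vert) (Sum.inl v) = Sum.inl (h v) := rfl

end IsFlip
end FreeInvolutions

/-! ### The lattice of left translations. -/

namespace FreeInvolutions

open SimpleGraph TreeWithFins

theorem isFlip_mul_left (u : FreeInvolutions) : IsFlip (u * ·) fun _ => false where
  map_gen v c := by
    have : flip false c = c := by cases c <;> simp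
    rw [this, mul_assoc]
  sign_some _ _ := rfl
  sign_fin _ _ := rfl

/-- The action of the free product on the tree with fins by left translations. -/
noncomputable def translation : FreeInvolutions →* finned.Aut :=
  MonoidHom.mk' (fun u => (isFlip_mul_left u).toAut (Group.mulLeft_bijective u)) <| by
    intro u v
    apply Subtype.ext
    apply Equiv.ext
    rintro (x | ⟨x | ⟨x, a, b⟩, k⟩)
    · exact congrArg Sum.inl (mul_assoc u v x)
    · refine congrArg Sum.inr (finned_ext (congrArg Sum.inl (mul_assoc u v x)) rfl)
    · refine congrArg Sum.inr (finned_ext ?_ rfl)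
      change (Sum.inr _ : FinIndex) = Sum.inr _
      simp [mul_assoc]

theorem translation_inl (u x : FreeInvolutions) :
    (translation u : Equiv.Perm finned.Vert) (Sum.inl x) = Sum.inl (u * x) := rfl

theorem translation_inr (u : FreeInvolutions) (a : Σ i, finned.Y i) :
    (translation u : Equiv.Perm finned.Vert) (Sum.inr a) =
      Sum.inr (finMap (u * ·) (fun _ => false) a) := rfl

theorem eq_one_of_translation_apply {u : FreeInvolutions} {v : finned.Vert}
    (h : (translation u : Equiv.Perm finned.Vert) v = v) : u = 1 := by
  rcases v with x | a
  · have h' : Sum.inl (u * (show FreeInvolutions from x)) = Sum.inl x :=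
      (translation_inl u x).symm.trans h
    exact mul_eq_right.1 (Sum.inl_injective h')
  · rw [translation_inr] at h
    have := (isFlip_mul_left u).base_finMap a
    rw [Sum.inr_injective h] at this
    exact mul_eq_right.1 this.symm

/-- The action is free on vertices, and the vertex 1 together with the vertices of the finitely many
fins starting at 1 meets every orbit. -/
theorem isUniformLattice_range_translation : IsUniformLattice translation.range := by
  constructor
  · intro v
    have : MulAction.stabilizer translation.range v = ⊥ := by
      rw [eq_bot_iff]
      rintro ⟨_, u, rfl⟩ h
      have hu : u = 1 := eq_one_of_translation_apply h
      subst hu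
      exact Subtype.ext (map_one translation)
    rw [this]
    infer_instance
  · let rep : Unit ⊕ Fin 2 ⊕ (Bool × Bool × Fin 8) → finned.Vert
      | .inl _ => Sum.inl (1 : FreeInvolutions)
      | .inr (.inl k) => Sum.inr ⟨Sum.inl 1, k⟩
      | .inr (.inr (a, b, k)) => Sum.inr ⟨Sum.inr (1, a, b), k⟩
    have key : ∀ v, ∃ t u, (translation u : Equiv.Perm finned.Vert) (rep t) = v := by
      rintro (x | ⟨x | ⟨x, a, b⟩, k⟩)
      · exact ⟨.inl (), x, congrArg Sum.inl (mul_one (M := FreeInvolutions) x)⟩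
      · exact ⟨.inr (.inl k), x,
          congrArg Sum.inr (finned_ext (congrArg Sum.inl (mul_one x)) rfl)⟩
      · refine ⟨.inr (.inr (a, b, k)), x, congrArg Sum.inr (finned_ext ?_ rfl)⟩
        change (Sum.inr _ : FinIndex) = Sum.inr _
        simp
    refine Finite.of_surjective
      (fun t => (Quotient.mk _ (rep t) : MulAction.orbitRel.Quotient translation.range finned.Vert))
      fun q => ?_
    induction q using Quotient.inductionOn with | _ v
    obtain ⟨t, u, rfl⟩ := key v
    exact ⟨t, Quotient.sound ⟨⟨translation u⁻¹, u⁻¹, rfl⟩, by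
      change (translation u⁻¹ : Equiv.Perm finned.Vert)
        ((translation u : Equiv.Perm finned.Vert) (rep t)) = rep t
      rw [← Equiv.Perm.mul_apply, ← Subgroup.coe_mul, ← map_mul]
      simp⟩⟩

/-! ### Existence of a flip with sign 1 at the identity. -/

/-- The inverse is built letter by letter, flipping each letter by the sign at the preimage reached
so far. This is well defined on reduced words because `σ` agrees at both ends of a `some` edge and
`none` is never flipped. -/
theorem IsFlip.bijective {h : FreeInvolutions → FreeInvolutions} {σ : FreeInvolutions → Bool}
    (H : IsFlip h σ) (h1 : h 1 = 1) : Function.Bijective h := by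
  let ρ : Option Bool → FreeInvolutions → FreeInvolutions := fun c v => v * gen (flip (σ v) c)
  have hρ : ∀ c v, ρ c (ρ c v) = v := by
    rintro (_ | b) v
    · simp [ρ]
    · simp [ρ, H.sign_some]
  have hflip : ∀ (s : Bool) c, flip s (flip s c) = c := by
    rintro s (_ | b) <;> simp
  refine Function.bijective_iff_has_inverse.2 ⟨lift ρ 1, fun v => ?_, fun v => ?_⟩
  · induction v using gen_induction with
    | one => rw [h1, lift_one]
    | mul v c ih =>
      rw [H.map_gen, lift_mul_gen hρ, ih]
      simp only [ρ, hflip]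
  · induction v using gen_induction with
    | one => rw [lift_one, h1]
    | mul v c ih =>
      rw [lift_mul_gen hρ]
      simp only [ρ]
      rw [H.map_gen, ih, hflip]

/-- An action of the free product on `(Z/2)^3` by linear involutions. A state `(s, c, d)` at a
vertex `v` records the signs at `v`, at `v * gen none` and at `v * gen (some false) * gen none`. -/
def transition : Option Bool → Bool × Bool × Bool → Bool × Bool × Bool
  -- The sign two steps further on, beyond the `none` edge, is a free choice; keeping `d` makes the
  -- transition an involution.
  | none, (s, c, d) => (c, s, d)
  | some false, (s, c, d) => (s, d, c)
  -- The sign across `none` from `v * gen (some true)` is forced by `sign_fin`: that vertex is two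
  -- steps along the line from `v * gen (some false)`, whence `s + d`. Likewise `s + c` lies two
  -- steps from `v`.
  | some true, (s, c, d) => (s, xor s d, xor s c)

/-- The transducer which flips the labels of a word according to the state. -/
def transducer (c : Option Bool) (z : FreeInvolutions × Bool × Bool × Bool) :
    FreeInvolutions × Bool × Bool × Bool :=
  (z.1 * gen (flip z.2.1 c), transition c z.2)

theorem transducer_transducer (c : Option Bool) (z : FreeInvolutions × Bool × Bool × Bool) :
    transducer c (transducer c z) = z := by
  have h1 : ∀ c t, transition c (transition c t) = t := by decide
  have h2 : ∀ c t, flip (transition c t).1 c = flip t.1 c := by decide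
  simp [transducer, h1, h2]

theorem exists_isFlip : ∃ h σ, IsFlip h σ ∧ h 1 = 1 ∧ σ 1 = true := by
  -- Only the first sign matters, giving `σ 1 = true`; the other two are arbitrary.
  let φ := lift transducer (1, true, false, false)
  have hφ : ∀ v c, φ (v * gen c) = transducer c (φ v) := lift_mul_gen transducer_transducer _
  refine ⟨fun v => (φ v).1, fun v => (φ v).2.1, ⟨fun v c => ?_, fun v b => ?_, fun v b => ?_⟩,
    rfl, rfl⟩
  · simp only [hφ]
    rfl
  · have h1 : ∀ b t, (transition (some b) t).1 = t.1 := by decide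
    simp only [hφ]
    exact h1 b _
  · have h1 : ∀ b t, (transition none (transition (some !b) (transition (some b) t))).1 =
      xor t.1 (transition none t).1 := by decide
    simp only [hφ]
    exact h1 b _

/-! ### Labels and signs of an arbitrary automorphism. -/

/-- The action of an automorphism on the vertices of the Cayley graph. -/
noncomputable def treeMap (g : finned.Aut) (v : FreeInvolutions) : FreeInvolutions := onV g v

theorem apply_inl_eq (g : finned.Aut) (v : FreeInvolutions) :
    (g : Equiv.Perm finned.Vert) (Sum.inl v) = Sum.inl (treeMap g v) := apply_inl g v

theorem treeMap_mul (g h : finned.Aut) (v : FreeInvolutions) :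
    treeMap (g * h) v = treeMap g (treeMap h v) := onV_mul g h v

theorem treeMap_one (v : FreeInvolutions) : treeMap 1 v = v := onV_one (X := finned) v

theorem treeMap_injective (g : finned.Aut) : Function.Injective (treeMap g) := onV_injective g

/-- A fin with two vertices must go to a fin with two vertices, and these lie exactly along the
`none` edges. -/
theorem treeMap_mul_gen_none (g : finned.Aut) (v : FreeInvolutions) :
    treeMap g (v * gen none) = treeMap g v * gen none := by
  obtain ⟨j, f, -, -, hγ⟩ := exists_fin_equiv g (Sum.inl v : FinIndex)
  rcases j with w | w
  · have hγ' : ∀ y : Fin 2, treeMap g (v * shortPath y) = w * shortPath (f y) := hγ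
    have h0 : treeMap g (v * 1) = w * shortPath (f (0 : Fin 2)) := hγ' 0
    have h1 : treeMap g (v * gen none) = w * shortPath (f (1 : Fin 2)) := hγ' 1
    have hne : f (0 : Fin 2) ≠ f (1 : Fin 2) := f.injective.ne (by decide : (0 : Fin 2) ≠ 1)
    generalize f (0 : Fin 2) = a at h0 hne
    generalize f (1 : Fin 2) = b at h1 hne
    change Fin 2 at a b
    rw [mul_one] at h0
    rw [h0, h1]
    fin_cases a <;> fin_cases b <;> first | exact absurd rfl hne | simp [shortPath]
  · have := Fintype.card_congr (show Fin 2 ≃ Fin 8 from f)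
    simp at this

/-- An automorphism maps long paths to long paths, preserving their direction. -/
theorem exists_long_fin (g : finned.Aut) (x : FreeInvolutions) (a b : Bool) :
    ∃ a' b', ∀ k : Fin 8,
      onE g ⟨(Sum.inr (x, a, b) : FinIndex), k⟩ = ⟨(Sum.inr (treeMap g x, a', b') : FinIndex), k⟩ ∧
      treeMap g (x * longPath a b k) = treeMap g x * longPath a' b' k := by
  obtain ⟨j, f, hf, hadj, hγ⟩ := exists_fin_equiv g (Sum.inr (x, a, b) : FinIndex)
  rcases j with w | ⟨y, a', b'⟩
  · have := Fintype.card_congr (show Fin 8 ≃ Fin 2 from f)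
    simp at this
  · have hγ' : ∀ k : Fin 8, treeMap g (x * longPath a b k) = y * longPath a' b' (f k) := hγ
    rcases pathGraph_rigid (f := f) f.injective hadj with h | h
    · have hx : treeMap g x = y := by
        have := hγ' 0
        rw [h] at this
        simpa [longPath] using this
      subst hx
      refine ⟨a', b', fun k => ⟨(hf k).trans (by rw [h]), ?_⟩⟩
      have := hγ' k
      rwa [h] at this
    -- A reversal would send the edge from position 1 to 2, labelled `none`, to the edge from
    -- position 6 to 5, labelled `some c`.
    · exfalso
      have h1 := hγ' 1
      have h2 := hγ' 2
      rw [h] at h1 h2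
      have h3 : treeMap g (x * longPath a b 2) = treeMap g (x * longPath a b 1) * gen none := by
        rw [← treeMap_mul_gen_none, mul_assoc]
        rfl
      rw [h1, h2, mul_assoc, mul_right_inj] at h3
      have h4 : longPath a' b' 6 = longPath a' b' 5 * gen (some (xor a' b')) := rfl
      change longPath a' b' 5 = longPath a' b' 6 * gen none at h3
      rw [h4] at h3
      have h5 := congrArg (· * gen none) h3
      simp only [mul_gen_gen, mul_gen_inj] at h5
      simp at h5

theorem exists_sign (g : finned.Aut) (v : FreeInvolutions) :
    ∃ s, ∀ c, treeMap g (v * gen c) = treeMap g v * gen (flip s c) := by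
  have key : ∀ c, ∃ d, treeMap g (v * gen c) = treeMap g v * gen d := fun c =>
    tree_adj_onV g (cayley_adj_mul_gen v c)
  choose d hd using key
  have hinj : Function.Injective d := fun c c' h => by
    have : treeMap g (v * gen c) = treeMap g (v * gen c') := by rw [hd, hd, h]
    exact mul_gen_inj.1 (treeMap_injective g this)
  have h0 : d none = none := mul_gen_inj.1 ((hd none).symm.trans (treeMap_mul_gen_none g v))
  have comb : ∀ d : Option Bool → Option Bool, Function.Injective d → d none = none →
      ∃ s, ∀ c, d c = flip s c := by
    decide
  obtain ⟨s, hs⟩ := comb d hinj h0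
  exact ⟨s, fun c => by rw [hd, hs]⟩

/-- Whether an automorphism interchanges the labels `some false` and `some true` at a vertex. -/
noncomputable def sign (g : finned.Aut) (v : FreeInvolutions) : Bool := (exists_sign g v).choose

theorem treeMap_mul_gen (g : finned.Aut) (v : FreeInvolutions) (c : Option Bool) :
    treeMap g (v * gen c) = treeMap g v * gen (flip (sign g v) c) :=
  (exists_sign g v).choose_spec c

/-- The image of a `some` edge has one label, whichever end it is read from. -/
theorem sign_mul_gen_some (g : finned.Aut) (v : FreeInvolutions) (b : Bool) :
    sign g (v * gen (some b)) = sign g v := by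
  have h := treeMap_mul_gen g (v * gen (some b)) (some b)
  rw [mul_gen_gen, treeMap_mul_gen] at h
  have h' := congrArg (· * gen (flip (sign g (v * gen (some b))) (some b))) h
  simp only [mul_gen_gen, mul_gen_inj] at h'
  simpa using h'

/-- The three signs are the shifts of the labels `a`, `b` and `c`, and both the fin and its image
satisfy `c = a + b`. -/
theorem sign_long (g : finned.Aut) (x : FreeInvolutions) (a b : Bool) :
    sign g (x * longPath a b 5) = xor (sign g x) (sign g (x * longPath a b 2)) := by
  obtain ⟨a', b', h⟩ := exists_long_fin g x a b
  have step : ∀ (k l : Fin 8) (c c' : Option Bool),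
      (longPath a b l = longPath a b k * gen c) →
      (longPath a' b' l = longPath a' b' k * gen c') →
      c' = flip (sign g (x * longPath a b k)) c := by
    intro k l c c' h1 h2
    have h3 := (h l).2
    rw [h1, h2, ← mul_assoc, ← mul_assoc, treeMap_mul_gen, (h k).2] at h3
    exact (mul_gen_inj.1 h3).symm
  have e1 := step 0 1 (some a) (some a') rfl rfl
  have e2 := step 2 3 (some b) (some b') rfl rfl
  have e3 := step 5 6 (some (xor a b)) (some (xor a' b')) rfl rfl
  have e0 : x * longPath a b 0 = x := mul_one x
  rw [e0] at e1
  rw [flip_some, Option.some_inj] at e1 e2 e3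
  subst e1 e2
  revert e3
  generalize sign g (x * longPath a b 5) = t
  generalize sign g (x * longPath a b 2) = s
  generalize sign g x = r
  cases r <;> cases s <;> cases t <;> cases a <;> cases b <;> simp

/-! ### Reflections have infinite order. -/

/-- An automorphism fixing `v` and interchanging the edges with labels `some false` and `some true`
at `v`. -/
def IsReflection (g : finned.Aut) (v : FreeInvolutions) : Prop :=
  treeMap g v = v ∧ sign g v = true

/-- `g` exchanges the vertices across the `none` edges from the two `some` neighbours of `v`. Its
signs there differ, since they lie two steps apart along a line of sign 1, so the sign of `g ^ 2` at
either one is their sum, 1. -/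
theorem IsReflection.sq {g : finned.Aut} {v : FreeInvolutions} (h : IsReflection g v) :
    IsReflection (g ^ 2) (v * gen (some false) * gen none) := by
  obtain ⟨h1, h2⟩ := h
  have k1 : treeMap g (v * gen (some false) * gen none) = v * gen (some true) * gen none := by
    rw [treeMap_mul_gen_none, treeMap_mul_gen, h1, h2]
    rfl
  have k2 : treeMap g (v * gen (some true) * gen none) = v * gen (some false) * gen none := by
    rw [treeMap_mul_gen_none, treeMap_mul_gen, h1, h2]
    rfl
  have k3 : treeMap (g ^ 2) (v * gen (some false) * gen none) =
      v * gen (some false) * gen none := by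
    rw [pow_two, treeMap_mul, k1, k2]
  refine ⟨k3, ?_⟩
  -- This long path runs through `v * gen (some false) * gen none` at position 1, then along the
  -- line through `v` at position 3, and reaches `v * gen (some true) * gen none` at position 5.
  have e := sign_long g (v * gen (some false) * gen none * gen (some false)) false false
  rw [sign_mul_gen_some] at e
  simp only [longPath] at e
  simp [← mul_assoc, sign_mul_gen_some, h2] at e
  have e1 := treeMap_mul_gen (g ^ 2) (v * gen (some false) * gen none) (some false)
  rw [k3, pow_two, treeMap_mul, treeMap_mul_gen, k1, flip_some, treeMap_mul_gen, k2, mul_gen_inj,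
    ← pow_two, flip_some, flip_some, Option.some_inj, e] at e1
  simpa using e1.symm

/-- An odd power exchanges the two `some` neighbours of `v`; for an even exponent, pass to the
reflection `g ^ 2` and halve the exponent. -/
theorem IsReflection.pow_ne_one {n : ℕ} (hn : 0 < n) : ∀ {g : finned.Aut} {v : FreeInvolutions},
    IsReflection g v → g ^ n ≠ 1 := by
  induction n using Nat.strong_induction_on with | _ n ih
  intro g v hg h
  obtain ⟨m, rfl | rfl⟩ := n.even_or_odd'
  · rw [pow_mul] at h
    exact ih m (by omega) (by omega) hg.sq h
  · obtain ⟨h1, h2⟩ := hg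
    have e : ∀ b, treeMap g (v * gen (some b)) = v * gen (some !b) := fun b => by
      rw [treeMap_mul_gen, h1, h2, flip_some, Bool.true_xor]
    have e2 : ∀ m, treeMap ((g ^ 2) ^ m) (v * gen (some true)) = v * gen (some true) := by
      intro m
      induction m with
      | zero => rw [pow_zero, treeMap_one]
      | succ m ih => rw [pow_succ, treeMap_mul, pow_two, treeMap_mul, e, e, Bool.not_not,
          ← pow_two, ih]
    have e3 := congrArg (treeMap · (v * gen (some false))) h
    rw [pow_succ, pow_mul, treeMap_mul, e, Bool.not_false, e2, treeMap_one, mul_gen_inj] at e3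
    simp at e3

/-! ### Lattices contain no reflections, and the two conclusions. -/

theorem not_isReflection_of_mem {Γ : Subgroup finned.Aut} (hΓ : IsUniformLattice Γ)
    {g : finned.Aut} (hg : g ∈ Γ) (v : FreeInvolutions) : ¬ IsReflection g v := by
  intro h
  have hfin := hΓ.1 (Sum.inl v)
  let γ : MulAction.stabilizer Γ (Sum.inl v : finned.Vert) := ⟨⟨g, hg⟩, by
    change (g : Equiv.Perm finned.Vert) (Sum.inl v) = Sum.inl v
    exact (apply_inl g _).trans (congrArg Sum.inl h.1)⟩
  obtain ⟨n, hn, h1⟩ := (isOfFinOrder_of_finite γ).exists_pow_eq_one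
  exact h.pow_ne_one hn (congrArg (fun γ => γ.1.1) h1)

theorem isReflection_of_apply {g : finned.Aut} {v : FreeInvolutions} (h1 : treeMap g v = v)
    {b : Bool} (h2 : treeMap g (v * gen (some b)) = v * gen (some !b)) : IsReflection g v := by
  refine ⟨h1, ?_⟩
  rw [treeMap_mul_gen, h1, mul_gen_inj, flip_some, Option.some_inj] at h2
  revert h2
  cases sign g v <;> cases b <;> simp

theorem exists_isReflection : ∃ g : finned.Aut, IsReflection g 1 := by
  obtain ⟨h, σ, H, h1, hσ⟩ := exists_isFlip
  have e : ∀ v, treeMap (H.toAut (H.bijective h1)) v = h v := fun v =>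
    Sum.inl_injective ((apply_inl _ _).symm.trans (H.toAut_inl (H.bijective h1) v))
  refine ⟨_, isReflection_of_apply (b := false) ((e 1).trans h1) ?_⟩
  rw [e, H.map_gen, h1, hσ]
  rfl

theorem not_injective_quotientMap {Γ : Subgroup finned.Aut} (hΓ : IsUniformLattice Γ) :
    ¬ Function.Injective (quotientMap Γ) := by
  intro hinj
  obtain ⟨g, hg1, hg2⟩ := exists_isReflection
  -- The first vertex of a long fin at 1 suffices: its image determines the image fin, and
  -- directions are preserved, so an element of `Γ` agreeing with `g` on `y` agrees with it along
  -- the whole path below that fin and is a reflection at 1.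
  let y : finned.Vert := finned.onFin (Sum.inr (1, false, false) : FinIndex) (0 : Fin 8)
  let c : finned.Cell := ⟨{y}, .finVertex _ _⟩
  have h1 : quotientMap Γ (Quotient.mk _ (g • c)) = quotientMap Γ (Quotient.mk _ c) :=
    Quotient.sound ⟨g, rfl⟩
  obtain ⟨⟨γ, hγ⟩, h2⟩ := Quotient.exact (hinj h1)
  have h3 : (γ : Equiv.Perm finned.Vert) '' {y} = (g : Equiv.Perm finned.Vert) '' {y} :=
    congrArg Subtype.val h2
  rw [Set.image_singleton, Set.image_singleton, Set.singleton_eq_singleton_iff] at h3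
  simp only [y, onFin] at h3
  rw [apply_inr, apply_inr] at h3
  obtain ⟨a, b, e⟩ := exists_long_fin g 1 false false
  obtain ⟨a', b', e'⟩ := exists_long_fin γ 1 false false
  have h4 := Sum.inr_injective h3
  rw [(e 0).1, (e' 0).1] at h4
  have h5 : (Sum.inr (treeMap γ 1, a', b') : FinIndex) = Sum.inr (treeMap g 1, a, b) :=
    congrArg Sigma.fst h4
  simp only [Sum.inr.injEq, Prod.mk.injEq] at h5
  obtain ⟨h6, rfl, rfl⟩ := h5
  refine not_isReflection_of_mem hΓ hγ 1 (isReflection_of_apply (b := false) (h6.trans hg1) ?_)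
  have h7 : treeMap γ (1 * gen (some false)) = treeMap g (1 * gen (some false)) := by
    have := ((e' 1).2.trans (by rw [h6])).trans (e 1).2.symm
    exact this
  rw [h7, treeMap_mul_gen, hg1, hg2]
  rfl

theorem not_forall_induces {Γ : Subgroup finned.Aut} (hΓ : IsUniformLattice Γ) :
    ¬ ∀ (x : finned.V) (π : Equiv.Perm (finned.edgesAt x)),
      (∃ g : finned.Aut, finned.Induces x g π) → ∃ g ∈ Γ, finned.Induces x g π := by
  intro hall
  obtain ⟨g, hg1, hg2⟩ := exists_isReflection
  obtain ⟨π, hπ⟩ := exists_induces (X := finned) (1 : FreeInvolutions) g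
    ((apply_inl g _).trans (congrArg Sum.inl hg1))
  obtain ⟨γ, hγ, hγ1, hγ2⟩ := hall _ π ⟨g, hπ⟩
  have h1 : treeMap γ 1 = 1 := Sum.inl_injective ((apply_inl γ _).symm.trans hγ1)
  let e : finned.edgesAt (1 : FreeInvolutions) :=
    ⟨_, 1 * gen (some false), cayley_adj_mul_gen 1 (some false), rfl⟩
  have h3 : ∀ g : finned.Aut, (g : Equiv.Perm finned.Vert) '' e.1 =
      {Sum.inl (treeMap g 1), Sum.inl (treeMap g (1 * gen (some false)))} := fun g => by
    rw [← apply_inl_eq, ← apply_inl_eq]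
    exact Set.image_pair _ _ _
  have h2 := (hγ2 e).symm.trans (hπ.2 e)
  rw [h3, h3, h1, hg1, treeMap_mul_gen g, hg1, hg2] at h2
  -- Edges are unordered vertex sets, so the possibility that the neighbour goes to 1 itself has to
  -- be excluded.
  have h4 := h2.subset (Set.mem_insert_of_mem _ rfl)
  have h5 : treeMap γ (1 * gen (some false)) ≠ 1 := by
    rw [treeMap_mul_gen, h1, one_mul]
    exact gen_ne_one _
  rcases h4 with h4 | h4
  · exact h5 (Sum.inl_injective h4)
  · exact not_isReflection_of_mem hΓ hγ 1 (isReflection_of_apply h1 (Sum.inl_injective h4))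

end FreeInvolutions

open FreeInvolutions in
theorem theorem1p4 :
    ∃ X : TreeWithFins, X.LocallyFinite ∧ X.IsUniform ∧
      (¬ ∃ Γ : Subgroup X.Aut, TreeWithFins.IsUniformLattice Γ ∧
        Function.Bijective (TreeWithFins.quotientMap Γ)) ∧
      (¬ ∃ Γ : Subgroup X.Aut, TreeWithFins.IsUniformLattice Γ ∧
        ∀ (x : X.V) (π : Equiv.Perm (X.edgesAt x)),
          (∃ g : X.Aut, X.Induces x g π) → ∃ g ∈ Γ, X.Induces x g π) := by
  exact ⟨finned, finned_locallyFinite, ⟨_, isUniformLattice_range_translation⟩,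
    fun ⟨_, hΓ, h⟩ => not_injective_quotientMap hΓ h.1,
    fun ⟨_, hΓ, h⟩ => not_forall_induces hΓ h⟩
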